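/- For a bounded measurable set $E\subset\mathbb{R}$ let $PW_E$ be the Hilbert space of all entire functions $f(z)=\int_E\varphi(t)e^{itz}\,dt$ with $\varphi\in L^2(E)$, equipped with the inner product $(f,g)=\int_{\mathbb{R}}f(x)\overline{g(x)}\,dx$, and let $k_\lambda(z)=\frac1{2\pi}\int_E e^{it(z-\bar\lambda)}\,dt$, $\lambda\in\mathbb{C}$, be its reproducing kernels. For an interval $J\subset E$, the projection of such an $f$ onto $PW_J$ is $z\mapsto\int_J\varphi(t)e^{itz}\,dt$. Let $N\ge 1$, let $I^1,\dots,I^N\subset\mathbb{R}$ be pairwise disjoint bounded nondegenerate intervals, $E=\bigcup_{j=1}^N I^j$, and let $|E|$ be the Lebesgue measure of $E$. Let $\Lambda\subset\mathbb{C}$ be such that $\{k_\lambda\}_{\lambda\in\Lambda}$ is complete in $PW_E$ (its linear span is dense) and minimal (no $k_\lambda$ lies in the closed linear span of the others), and such that $$\limsup_{R\to\infty}\frac{\#(\Lambda\cap B(0,R))}{2R}=\frac{|E|}{2\pi},$$ where $B(0,R)$ is the disk of radius $R$ centred at $0$. Let $\{f_\lambda\}_{\lambda\in\Lambda}\subset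 PW_E$ be the biorthogonal system: $(f_\lambda,k_\mu)=1$ if $\lambda=\mu$ and $(f_\lambda,k_\mu)=0$ if $\lambda\neq\mu$, for $\lambda,\mu\in\Lambda$. Let $\lambda_1,\dots,\lambda_N\in\Lambda$ be such that the functions $$F_k(z)=(z-\lambda_k)f_{\lambda_k}(z),\qquad k=1,\dots,N,$$ are linearly independent. Write $F_k=\sum_{j=1}^N F_k^j$, where $F_k^j(z)=(z-\lambda_k)f_{\lambda_k}^j(z)$ and $f_{\lambda_k}^j$ is the projection of $f_{\lambda_k}$ onto $PW_{I^j}$ (so that $F_k^j$ has its spectrum in $I^j$). Then: 1. For every $\lambda\in\Lambda$ and every $1\le l\le N$ there is a constant $c_{\lambda,l}\neq0$ such that $$f_\lambda(z)=\frac{c_{\lambda,l}}{z-\lambda}\sum_{k=1}^N a_k^l(\lambda)F_k(z)\qquad(z\neq\lambda),$$ where $a_k^l(\lambda)=(-1)^{k+l}\det\big(F_i^j(\lambda)\big)_{i\neq k,\;j\neq l}$ is the cofactor of the entry $F_k^l(\lambda)$ of the matrix $\big(F_k^j(\lambda)\big)_{1\le k,j\le N}$ (for $N=1$ it equals $1$).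 2. The function $S(z)=\det\big(F_k^j(z)\big)_{1\le k,j\le N}$ is entire, its zero set is exactly $\Lambda$, and all its zeros are simple. -/

import Mathlib

open MeasureTheory Filter
open scoped ENNReal

noncomputable section

/-- The Fourier transform `z ↦ ∫_E φ(t) e^{itz} dt` of a function `φ` on `E ⊆ ℝ`, as a function
on the complex plane. -/
def pwTransform (E : Set ℝ) (φ : ℝ → ℂ) (z : ℂ) : ℂ :=
  ∫ t in E, φ t * Complex.exp (Complex.I * (t : ℂ) * z)

/-- The Paley-Wiener space `PW_E`: all functions `z ↦ ∫_E φ(t) e^{itz} dt` with `φ ∈ L²(E)`.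
Its Hilbert space structure is the one of `L²(ℝ)`, through restriction to the real line. -/
def PaleyWiener (E : Set ℝ) : Set (ℂ → ℂ) :=
  {f | ∃ φ : ℝ → ℂ, MemLp φ 2 (volume.restrict E) ∧ f = pwTransform E φ}

/-- The reproducing kernel of `PW_E` at the point `μ`,
`k_μ(z) = (1 / 2π) ∫_E e^{it(z - conj μ)} dt`. -/
def pwKernel (E : Set ℝ) (μ : ℂ) (z : ℂ) : ℂ :=
  (1 / (2 * (Real.pi : ℂ))) *
    ∫ t in E, Complex.exp (Complex.I * (t : ℂ) * (z - (starRingEnd ℂ) μ))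

/-- The `L²(ℝ)` inner product of (the restrictions to `ℝ` of) two functions on `ℂ`. -/
def realLineInner (f g : ℂ → ℂ) : ℂ :=
  ∫ x : ℝ, f (x : ℂ) * (starRingEnd ℂ) (g (x : ℂ))

/-- The `L²(ℝ)` distance of (the restrictions to `ℝ` of) two functions on `ℂ`. -/
def realLineDist (f g : ℂ → ℂ) : ℝ≥0∞ :=
  eLpNorm (fun x : ℝ => f (x : ℂ) - g (x : ℂ)) 2 volume

/-- The system `u` is complete in `V`: its finite linear combinations are dense in `V` for the
`L²(ℝ)` norm. -/
def IsCompleteSystem {ι : Type*} (V : Set (ℂ → ℂ)) (u : ι → ℂ → ℂ) : Prop :=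
  ∀ f ∈ V, ∀ ε : ℝ≥0∞, 0 < ε → ∃ g ∈ Submodule.span ℂ (Set.range u), realLineDist f g < ε

/-- The system `u` is minimal: no element lies in the closed linear span of the others. -/
def IsMinimalSystem {ι : Type*} (u : ι → ℂ → ℂ) : Prop :=
  ∀ i, ∃ ε : ℝ≥0∞, 0 < ε ∧
    ∀ g ∈ Submodule.span ℂ (u '' {j | j ≠ i}), ε ≤ realLineDist (u i) g

/-- The system `f` lies in `V` and is biorthogonal to `u`. -/
def IsBiorthogonalSystem {ι : Type*} (V : Set (ℂ → ℂ)) (u f : ι → ℂ → ℂ) : Prop :=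
  (∀ i, f i ∈ V) ∧ (∀ i, realLineInner (f i) (u i) = 1) ∧
    ∀ i j, i ≠ j → realLineInner (f i) (u j) = 0

/-- The upper density `limsup_{R → ∞} #(Λ ∩ B(0,R)) / (2R)`. -/
def upperDensity (Λ : Set ℂ) : ℝ≥0∞ :=
  limsup (fun R : ℝ => ((Λ ∩ Metric.ball (0 : ℂ) R).encard : ℝ≥0∞) / ENNReal.ofReal (2 * R)) atTop

/-- A bounded nondegenerate interval of the real line; it may or may not contain its endpoints. -/
def IsBoundedInterval (J : Set ℝ) : Prop :=
  J.OrdConnected ∧ Bornology.IsBounded J ∧ J.Nontrivial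

open Classical in
/-- For `f(z) = ∫_E φ(t) e^{itz} dt` in `PW_E` and `J ⊆ E`, the projection
`z ↦ ∫_J φ(t) e^{itz} dt` of `f` onto `PW_J`. The function `φ ∈ L²(E)` is determined by `f` up to
a null set (when `E` is bounded and measurable), so the projection is determined by `f`. -/
def pwComponent (E J : Set ℝ) (f : ℂ → ℂ) : ℂ → ℂ :=
  if h : f ∈ PaleyWiener E then pwTransform J h.choose else 0

/-- `F_μ(z) = (z - μ) f_μ(z)`, for a system `f` indexed by `Λ`. -/
def bigF {Λ : Set ℂ} (f : Λ → ℂ → ℂ) (μ : Λ) (z : ℂ) : ℂ :=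
  (z - (μ : ℂ)) * f μ z

/-- The part of `F_μ(z) = (z - μ) f_μ(z)` with spectrum in `J`: it is `z - μ` times the
projection of `f_μ ∈ PW_E` onto `PW_J`. -/
def bigFPart (E J : Set ℝ) {Λ : Set ℂ} (f : Λ → ℂ → ℂ) (μ : Λ) (z : ℂ) : ℂ :=
  (z - (μ : ℂ)) * pwComponent E J (f μ) z

/-- The matrix `(F_k^j(z))` with row index `k` and column index `j`, where `F_k = F_{λ_k}` and
`F_k^j` is its part with spectrum in the interval `I j`, for `E` the union of all `I j`. -/
def partMatrix {n : ℕ} (I : Fin (n + 1) → Set ℝ) {Λ : Set ℂ} (f : Λ → ℂ → ℂ)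
    (lam : Fin (n + 1) → Λ) (z : ℂ) : Matrix (Fin (n + 1)) (Fin (n + 1)) ℂ :=
  Matrix.of fun k j => bigFPart (⋃ i, I i) (I j) f (lam k) z

/-- The cofactor of the entry in row `k` and column `l`: `(-1)^(k+l)` times the determinant of
the matrix with row `k` and column `l` deleted. -/
def cofactor {n : ℕ} (M : Matrix (Fin (n + 1)) (Fin (n + 1)) ℂ) (k l : Fin (n + 1)) : ℂ :=
  (-1) ^ ((k : ℕ) + (l : ℕ)) * (M.submatrix k.succAbove l.succAbove).det

end

/-! ### Plancherel for the Fourier integral on `L¹ ∩ L²` -/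

open scoped FourierTransform ComplexConjugate Topology

/-! By the reproducing property `f_μ(ν) = δ_{μν}` on `Λ`, so every `F_k` vanishes on `Λ`. By
completeness, `Λ` is a uniqueness set for `PW_E`.

Let `a` be a left null vector of `M(w) = (F_k^j(w))`. Then every part of `∑ a_k F_k` vanishes at
`w`. On a single interval a zero can be divided out without enlarging the spectrum, so `∑ a_k F_k =
(z - w) g` with `g ∈ PW_E` (`exists_paleyWiener_sub_mul`), and `g` vanishes on `Λ \ {w}`. If `w ∉
Λ`, then `g = 0`, and independence of the `F_k` gives `a = 0`: `S(w) ≠ 0`. If `w = μ ∈ Λ`, then `g =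
g(μ) f_μ`, so `∑ a_k F_k` is a multiple of `F_μ`, and the left kernel is at most a line.

At `μ ∈ Λ` the row sums `F_k(μ)` are zero, so `S(μ) = 0` and each column of cofactors is a left null
vector. It is nonzero (`exists_cofactor_ne_zero`), which gives the formula for `f_μ`. Summing the
columns, `S = ∑ a_k^l F_k` identically. As `F_k(μ) = 0`, `S'(μ) = ∑ a_k^l(μ) F_k'(μ)` is a nonzero
multiple of `F_μ'(μ) = f_μ(μ) = 1`, so the zero is simple. -/

theorem continuous_fourier_of_integrable {f : ℝ → ℂ} (hf : Integrable f) : Continuous (𝓕 f) :=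
  VectorFourier.fourierIntegral_continuous Real.continuous_fourierChar
    (by exact continuous_inner) hf

theorem integral_smul_fourier_eq {f g : ℝ → ℂ} (hf : Integrable f) (hg : Integrable g) :
    ∫ x, 𝓕 f x • g x = ∫ x, f x • 𝓕 g x := by
  have h := VectorFourier.integral_fourierIntegral_smul_eq_flip (L := innerₗ ℝ) (μ := volume)
    (ν := volume) Real.continuous_fourierChar (by exact continuous_inner) hf hg
  rwa [flip_innerₗ] at h

/-- On `L¹ ∩ L²` the `L²` Fourier transform is given by the Fourier integral. -/
theorem coeFn_fourier_toLp {f : ℝ → ℂ} (h1 : Integrable f) (h2 : MemLp f 2) :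
    ((𝓕 (h2.toLp f) : Lp ℂ 2 (volume : Measure ℝ)) : ℝ → ℂ) =ᵐ[volume] 𝓕 f := by
  -- Test against smooth compactly supported `g`: as a tempered distribution, the `L²` transform
  -- moves `𝓕` onto `g`, and the multiplication formula moves it back onto `f`.
  refine ae_eq_of_integral_contDiff_smul_eq
    ((Lp.memLp _).locallyIntegrable (by norm_num))
    (continuous_fourier_of_integrable h1).locallyIntegrable ?_
  intro g hg hgc
  have hgC : ContDiff ℝ (⊤ : ℕ∞) (fun x => (g x : ℂ)) := Complex.ofRealCLM.contDiff.comp hg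
  have hgCc : HasCompactSupport (fun x => (g x : ℂ)) := hgc.comp_left Complex.ofReal_zero
  set G : SchwartzMap ℝ ℂ := hgCc.toSchwartzMap hgC with hG
  have hGx : ∀ x, G x = (g x : ℂ) := fun x => rfl
  have key := congrArg (fun T => T G) (Lp.fourier_toTemperedDistribution_eq (h2.toLp f))
  simp only [TemperedDistribution.fourier_apply, Lp.toTemperedDistribution_apply] at key
  have h3 : ∫ x, (𝓕 G) x • (h2.toLp f) x = ∫ x, (𝓕 G) x • f x := by
    refine integral_congr_ae ?_
    filter_upwards [h2.coeFn_toLp] with x hx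
    rw [hx]
  rw [h3, SchwartzMap.fourier_coe, integral_smul_fourier_eq G.integrable h1] at key
  simpa [hGx] using key.symm

theorem memLp_fourier {f : ℝ → ℂ} (h1 : Integrable f) (h2 : MemLp f 2) : MemLp (𝓕 f) 2 :=
  (memLp_congr_ae (coeFn_fourier_toLp h1 h2)).1 (Lp.memLp _)

theorem integral_fourier_mul_conj_fourier {f g : ℝ → ℂ} (hf1 : Integrable f) (hf2 : MemLp f 2)
    (hg1 : Integrable g) (hg2 : MemLp g 2) :
    ∫ x, 𝓕 f x * conj (𝓕 g x) = ∫ x, f x * conj (g x) := by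
  have h := Lp.inner_fourier_eq (hg2.toLp g) (hf2.toLp f)
  rw [L2.inner_def, L2.inner_def] at h
  have e1 : ∫ x, 𝓕 f x * conj (𝓕 g x) = ∫ x, inner ℂ ((𝓕 (hg2.toLp g) : Lp ℂ 2 _) x)
      ((𝓕 (hf2.toLp f) : Lp ℂ 2 _) x) := by
    refine integral_congr_ae ?_
    filter_upwards [coeFn_fourier_toLp hf1 hf2, coeFn_fourier_toLp hg1 hg2] with x hx hy
    rw [hx, hy, RCLike.inner_apply]
  have e2 : ∫ x, f x * conj (g x) = ∫ x, inner ℂ ((hg2.toLp g) x) ((hf2.toLp f) x) := by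
    refine integral_congr_ae ?_
    filter_upwards [hf2.coeFn_toLp, hg2.coeFn_toLp] with x hx hy
    rw [hx, hy, RCLike.inner_apply]
  rw [e1, e2, h]

/-! ### Paley-Wiener spaces: reproducing kernels and uniqueness sets -/

section PaleyWiener

variable {E : Set ℝ} {φ ψ : ℝ → ℂ}

/-- `𝓕` has the kernel `e^{-2πitx}`, whence the scaling by `-2π`. It produces the factor `2π` in
`realLineInner_pwTransform`, which the `1/(2π)` in the kernels cancels. -/
theorem pwTransform_ofReal_eq_fourier (hE : MeasurableSet E) (φ : ℝ → ℂ) (x : ℝ) :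
    pwTransform E φ x = 𝓕 (E.indicator φ) (x / (-(2 * Real.pi))) := by
  rw [Real.fourier_real_eq_integral_exp_smul, pwTransform, ← integral_indicator hE]
  congr 1
  ext t
  by_cases ht : t ∈ E
  · simp only [Set.indicator_of_mem ht, smul_eq_mul]
    rw [mul_comm]
    congr 2
    have : (Real.pi : ℂ) ≠ 0 := by exact_mod_cast Real.pi_ne_zero
    push_cast
    field_simp
  · simp [ht]

theorem integrableOn_of_memLp_two (hb : Bornology.IsBounded E)
    (hφ : MemLp φ 2 (volume.restrict E)) : IntegrableOn φ E := by
  have : IsFiniteMeasure (volume.restrict E) :=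
    ⟨by simpa using hb.measure_lt_top⟩
  exact hφ.integrable (by norm_num)

theorem memLp_pwTransform (hE : MeasurableSet E) (hb : Bornology.IsBounded E)
    (hφ : MemLp φ 2 (volume.restrict E)) : MemLp (fun x : ℝ => pwTransform E φ x) 2 := by
  have h1 := (integrable_indicator_iff hE).2 (integrableOn_of_memLp_two hb hφ)
  have hF := memLp_fourier h1 ((memLp_indicator_iff_restrict hE).2 hφ)
  simp_rw [pwTransform_ofReal_eq_fourier hE]
  have hc : Continuous fun x : ℝ => 𝓕 (E.indicator φ) (x / (-(2 * Real.pi))) :=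
    (continuous_fourier_of_integrable h1).comp (continuous_id.div_const _)
  rw [memLp_two_iff_integrable_sq_norm hc.aestronglyMeasurable]
  exact ((memLp_two_iff_integrable_sq_norm hF.1).1 hF).comp_div
    (neg_ne_zero.2 (by positivity))

theorem realLineInner_pwTransform (hE : MeasurableSet E) (hb : Bornology.IsBounded E)
    (hφ : MemLp φ 2 (volume.restrict E)) (hψ : MemLp ψ 2 (volume.restrict E)) :
    realLineInner (pwTransform E φ) (pwTransform E ψ) =
      2 * Real.pi * ∫ t in E, φ t * conj (ψ t) := by
  unfold realLineInner
  simp_rw [pwTransform_ofReal_eq_fourier hE]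
  rw [Measure.integral_comp_div
    (fun y => 𝓕 (E.indicator φ) y * conj (𝓕 (E.indicator ψ) y)) (-(2 * Real.pi)),
    integral_fourier_mul_conj_fourier
      ((integrable_indicator_iff hE).2 (integrableOn_of_memLp_two hb hφ))
      ((memLp_indicator_iff_restrict hE).2 hφ)
      ((integrable_indicator_iff hE).2 (integrableOn_of_memLp_two hb hψ))
      ((memLp_indicator_iff_restrict hE).2 hψ),
    abs_neg, abs_of_pos (by positivity), ← integral_indicator hE, Complex.real_smul]
  push_cast
  congr 2
  ext t
  by_cases ht : t ∈ E <;> simp [ht]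

theorem memLp_restrict_of_continuous (hb : Bornology.IsBounded E) (hφ : Continuous φ) :
    MemLp φ 2 (volume.restrict E) := by
  obtain ⟨C, hC⟩ := hb.isCompact_closure.exists_bound_of_continuousOn hφ.continuousOn
  have : IsFiniteMeasure (volume.restrict (closure E)) :=
    ⟨by simpa using hb.isCompact_closure.measure_lt_top⟩
  have h : MemLp φ 2 (volume.restrict (closure E)) :=
    MemLp.of_bound hφ.aestronglyMeasurable C
      (by filter_upwards [ae_restrict_mem isClosed_closure.measurableSet] with x hx using hC x hx)
  exact h.mono_measure (Measure.restrict_mono subset_closure le_rfl)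

theorem pwKernel_eq_pwTransform (E : Set ℝ) (μ : ℂ) :
    pwKernel E μ = pwTransform E
      (fun t => 1 / (2 * Real.pi) * Complex.exp (-(Complex.I * t * conj μ))) := by
  ext z
  unfold pwKernel pwTransform
  rw [← integral_const_mul]
  congr 1
  ext t
  simp only [mul_assoc, ← Complex.exp_add]
  ring_nf

theorem memLp_pwKernel_density (hb : Bornology.IsBounded E) (μ : ℂ) :
    MemLp (fun t : ℝ => 1 / (2 * (Real.pi : ℂ)) * Complex.exp (-(Complex.I * t * conj μ))) 2
      (volume.restrict E) :=
  memLp_restrict_of_continuous hb (by fun_prop)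

/-- The reproducing property of the kernels `k_μ`. -/
theorem realLineInner_pwKernel (hE : MeasurableSet E) (hb : Bornology.IsBounded E)
    {f : ℂ → ℂ} (hf : f ∈ PaleyWiener E) (μ : ℂ) :
    realLineInner f (pwKernel E μ) = f μ := by
  obtain ⟨φ, hφ, rfl⟩ := hf
  rw [pwKernel_eq_pwTransform, realLineInner_pwTransform hE hb hφ (memLp_pwKernel_density hb μ),
    pwTransform, ← integral_const_mul]
  congr 1
  ext t
  have : (Real.pi : ℂ) ≠ 0 := by exact_mod_cast Real.pi_ne_zero
  simp only [map_mul, map_div₀, map_one, map_ofNat, Complex.conj_ofReal, ← Complex.exp_conj,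
    map_neg, Complex.conj_I, Complex.conj_conj]
  field_simp

theorem pwTransform_eq_zero_of_realLineInner_self (hE : MeasurableSet E)
    (hb : Bornology.IsBounded E) (hφ : MemLp φ 2 (volume.restrict E))
    (h : realLineInner (pwTransform E φ) (pwTransform E φ) = 0) : pwTransform E φ = 0 := by
  rw [realLineInner_pwTransform hE hb hφ hφ] at h
  have hpi : (2 * Real.pi : ℂ) ≠ 0 := by exact_mod_cast Real.two_pi_pos.ne'
  have h0 := (mul_eq_zero.1 h).resolve_left hpi
  have h1 : ∫ t in E, ‖φ t‖ ^ 2 = 0 := by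
    have : ∀ t, φ t * conj (φ t) = ((‖φ t‖ ^ 2 : ℝ) : ℂ) := fun t => by
      rw [Complex.mul_conj']; norm_cast
    simp_rw [this, integral_complex_ofReal] at h0
    exact_mod_cast h0
  rw [integral_eq_zero_iff_of_nonneg (fun t => by positivity)
    ((memLp_two_iff_integrable_sq_norm hφ.1).1 hφ)] at h1
  ext z
  unfold pwTransform
  refine integral_eq_zero_of_ae ?_
  filter_upwards [h1] with t ht
  have : φ t = 0 := by simpa using ht
  simp [this]

/-- Pythagoras: `‖f - g‖² = ‖f‖² + ‖g‖²` for orthogonal `f`, `g`. -/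
theorem eLpNorm_le_realLineDist {f g : ℂ → ℂ} (hf : MemLp (fun x : ℝ => f x) 2)
    (hg : MemLp (fun x : ℝ => g x) 2) (h : realLineInner f g = 0) :
    eLpNorm (fun x : ℝ => f x) 2 ≤ realLineDist f g := by
  have hi : inner ℂ (hg.toLp _) (hf.toLp _) = 0 := by
    rw [L2.inner_def, ← h, realLineInner]
    refine integral_congr_ae ?_
    filter_upwards [hf.coeFn_toLp, hg.coeFn_toLp] with x hx hy
    rw [hx, hy, RCLike.inner_apply]
  have hn : ‖hf.toLp _‖ ≤ ‖hf.toLp _ - hg.toLp _‖ := by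
    have h2 := norm_sub_sq (𝕜 := ℂ) (hf.toLp _) (hg.toLp _)
    rw [← inner_conj_symm, hi] at h2
    simp only [map_zero, mul_zero, sub_zero] at h2
    refine (sq_le_sq₀ (norm_nonneg _) (norm_nonneg _)).1 ?_
    rw [h2]
    exact le_add_of_nonneg_right (sq_nonneg _)
  rw [← MemLp.toLp_sub, Lp.norm_toLp, Lp.norm_toLp] at hn
  exact (ENNReal.toReal_le_toReal hf.2.ne (hf.sub hg).2.ne).1 hn

/-- If the kernels at the points of `Λ` are complete, then `Λ` is a uniqueness set. -/
theorem eq_zero_of_forall_apply_eq_zero (hE : MeasurableSet E) (hb : Bornology.IsBounded E)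
    {Λ : Set ℂ} (hc : IsCompleteSystem (PaleyWiener E) (fun μ : Λ => pwKernel E (μ : ℂ)))
    {f : ℂ → ℂ} (hf : f ∈ PaleyWiener E) (h0 : ∀ μ ∈ Λ, f μ = 0) : f = 0 := by
  have hL : ∀ g ∈ PaleyWiener E, MemLp (fun x : ℝ => g x) 2 := by
    rintro _ ⟨φ, hφ, rfl⟩
    exact memLp_pwTransform hE hb hφ
  have hk : ∀ μ, pwKernel E μ ∈ PaleyWiener E := fun μ =>
    ⟨_, memLp_pwKernel_density hb μ, pwKernel_eq_pwTransform E μ⟩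
  have horth : ∀ g ∈ Submodule.span ℂ (Set.range fun μ : Λ => pwKernel E (μ : ℂ)),
      MemLp (fun x : ℝ => g x) 2 ∧ realLineInner f g = 0 := by
    intro g hg
    induction hg using Submodule.span_induction with
    | mem g hg =>
      obtain ⟨μ, rfl⟩ := hg
      exact ⟨hL _ (hk μ), by
        rw [realLineInner_pwKernel hE hb hf]
        exact h0 μ μ.2⟩
    | zero => exact ⟨MemLp.zero, by simp [realLineInner]⟩
    | add g₁ g₂ _ _ h₁ h₂ =>
      refine ⟨h₁.1.add h₂.1, ?_⟩
      have e : realLineInner f (g₁ + g₂) = realLineInner f g₁ + realLineInner f g₂ := by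
        have i₁ : Integrable fun x : ℝ => f x * conj (g₁ x) := (hL f hf).integrable_mul h₁.1.star
        have i₂ : Integrable fun x : ℝ => f x * conj (g₂ x) := (hL f hf).integrable_mul h₂.1.star
        unfold realLineInner
        rw [← integral_add i₁ i₂]
        simp [mul_add]
      rw [e, h₁.2, h₂.2, add_zero]
    | smul c g _ h₁ =>
      refine ⟨h₁.1.const_smul c, ?_⟩
      have e : realLineInner f (c • g) = conj c * realLineInner f g := by
        unfold realLineInner
        rw [← integral_const_mul]
        congr 1
        ext x
        simp only [Pi.smul_apply, smul_eq_mul, map_mul]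
        ring
      rw [e, h₁.2, mul_zero]
  -- Everything in the span is at distance at least `‖f‖` from `f`, so completeness with `ε = ‖f‖`
  -- forces `‖f‖ = 0`.
  have hz : eLpNorm (fun x : ℝ => f x) 2 = 0 := by
    by_contra hne
    obtain ⟨g, hg, hlt⟩ := hc f hf _ (pos_iff_ne_zero.2 hne)
    exact absurd (eLpNorm_le_realLineDist (hL f hf) (horth g hg).1 (horth g hg).2) (not_le.2 hlt)
  rw [eLpNorm_eq_zero_iff (hL f hf).1 (by norm_num)] at hz
  obtain ⟨φ, hφ, rfl⟩ := hf
  -- So far `f = 0` only a.e. on `ℝ`; passing through the density gives `f = 0` on all of `ℂ`.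
  refine pwTransform_eq_zero_of_realLineInner_self hE hb hφ (integral_eq_zero_of_ae ?_)
  filter_upwards [hz] with x hx
  simp only [Pi.zero_apply] at hx ⊢
  rw [hx, zero_mul]

end PaleyWiener

/-! ### Dividing out a zero on one interval -/

section Division

variable {E J : Set ℝ} {φ ψ : ℝ → ℂ}

theorem IsBoundedInterval.ae_eq_Ioc (hJ : IsBoundedInterval J) :
    J =ᵐ[volume] Set.Ioc (sInf J) (sSup J) := by
  obtain ⟨hc, hb, hn⟩ := hJ
  have hcon : IsConnected J := ⟨hn.nonempty, hc.isPreconnected⟩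
  have h1 : Set.Ioo (sInf J) (sSup J) ⊆ J := hcon.Ioo_csInf_csSup_subset hb.bddBelow hb.bddAbove
  have h2 : J ⊆ Set.Icc (sInf J) (sSup J) := subset_Icc_csInf_csSup hb.bddBelow hb.bddAbove
  have h3 := h1.eventuallyLE (l := ae (volume : Measure ℝ))
  have h4 := h2.eventuallyLE (l := ae (volume : Measure ℝ))
  exact (h4.trans_eq Ioc_ae_eq_Icc.symm).antisymm (Ioo_ae_eq_Ioc.symm.trans_le h3)

theorem pwTransform_congr_set {K : Set ℝ} (h : J =ᵐ[volume] K) (φ : ℝ → ℂ) :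
    pwTransform J φ = pwTransform K φ := by
  ext z
  rw [pwTransform, pwTransform, Measure.restrict_congr_set h]

theorem integrableOn_mul_continuous (hb : Bornology.IsBounded J) (hφ : IntegrableOn φ J)
    {u : ℝ → ℂ} (hu : Continuous u) : IntegrableOn (fun t => φ t * u t) J := by
  obtain ⟨C, hC⟩ := hb.isCompact_closure.exists_bound_of_continuousOn hu.continuousOn
  have hm := hφ.aestronglyMeasurable.mul (hu.aestronglyMeasurable (μ := volume.restrict J))
  refine Integrable.mono' (hφ.norm.mul_const C) hm ?_
  have hcl : ∀ᵐ t ∂volume.restrict J, t ∈ closure J :=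
    ae_restrict_of_ae_restrict_of_subset subset_closure
      (ae_restrict_mem isClosed_closure.measurableSet)
  filter_upwards [hcl] with t ht
  rw [norm_mul]
  exact mul_le_mul_of_nonneg_left (hC t ht) (norm_nonneg _)

theorem integrableOn_pwTransform (hb : Bornology.IsBounded J) (hφ : IntegrableOn φ J) (z : ℂ) :
    IntegrableOn (fun t : ℝ => φ t * Complex.exp (Complex.I * t * z)) J :=
  integrableOn_mul_continuous hb hφ (by fun_prop)

theorem integral_indicator_Ici_exp {a b s : ℝ} (hs : s ∈ Set.Ioc a b) {u : ℂ} (hu : u ≠ 0) :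
    ∫ t in Set.Ioc a b, (Set.Ici s).indicator (fun t : ℝ => Complex.exp (Complex.I * t * u)) t =
      (Complex.exp (Complex.I * b * u) - Complex.exp (Complex.I * s * u)) / (Complex.I * u) := by
  rw [setIntegral_indicator measurableSet_Ici]
  have : Set.Ioc a b ∩ Set.Ici s = Set.Icc s b := by
    ext t
    simp only [Set.mem_inter_iff, Set.mem_Ioc, Set.mem_Ici, Set.mem_Icc]
    exact ⟨fun h => ⟨h.2, h.1.2⟩, fun h => ⟨⟨hs.1.trans_le h.1, h.2⟩, h.1⟩⟩
  rw [this, integral_Icc_eq_integral_Ioc, ← intervalIntegral.integral_of_le hs.2]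
  have := integral_exp_mul_complex (a := s) (b := b) (mul_ne_zero Complex.I_ne_zero hu)
  simp_rw [mul_right_comm _ u] at this
  exact this

/-- Division by `z - w` of a transform on an interval that vanishes at `w`. -/
theorem exists_pwTransform_Ioc_eq_sub_mul {a b : ℝ} (hφ : IntegrableOn φ (Set.Ioc a b)) {w : ℂ}
    (h0 : pwTransform (Set.Ioc a b) φ w = 0) :
    ∃ ψ : ℝ → ℂ, MemLp ψ 2 (volume.restrict (Set.Ioc a b)) ∧
      ∀ z, pwTransform (Set.Ioc a b) φ z = (z - w) * pwTransform (Set.Ioc a b) ψ z := by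
  set ν := volume.restrict (Set.Ioc a b) with hν
  have hb : Bornology.IsBounded (Set.Ioc a b) := Metric.isBounded_Ioc a b
  set g : ℝ → ℂ := fun s => φ s * Complex.exp (Complex.I * s * w) with hg
  have hgi : Integrable g ν := integrableOn_pwTransform hb hφ w
  have hms : MeasurableSet {p : ℝ × ℝ | p.2 ≤ p.1} := measurableSet_le measurable_snd measurable_fst
  -- `Φ(t) = ∫_a^t φ(s) e^{isw} ds`, and the quotient has density `-i e^{-itw} Φ(t)`. The indicator
  -- form lets Fubini replace integration by parts, since `φ` is merely integrable.
  set Φ : ℝ → ℂ := fun t => ∫ s, (Set.Ici s).indicator (fun _ => g s) t ∂ν with hΦ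
  have hprod : ∀ v : ℝ → ℂ, Continuous v →
      Integrable (Function.uncurry fun t s => (Set.Ici s).indicator (fun t => v t * g s) t)
        (ν.prod ν) := by
    intro v hv
    have hvi : Integrable v ν := hv.integrableOn_Ioc
    refine ((hvi.mul_prod hgi).indicator hms).congr (ae_of_all _ ?_)
    rintro ⟨t, s⟩
    simp [Set.indicator, Function.uncurry]
  have hΦm : AEStronglyMeasurable Φ ν := by
    have := (hprod (fun _ => 1) continuous_const).integral_prod_left.aestronglyMeasurable
    simpa [Function.uncurry, hΦ] using this
  have hΦL : MemLp Φ 2 ν := by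
    refine MemLp.of_bound hΦm (∫ s, ‖g s‖ ∂ν) (ae_of_all _ fun t => ?_)
    refine norm_integral_le_of_norm_le hgi.norm (ae_of_all _ fun s => ?_)
    exact norm_indicator_le_norm_self (fun _ => g s) t
  set e : ℝ → ℂ := fun t => -Complex.I * Complex.exp (-(Complex.I * t * w)) with he
  have hec : Continuous e := by fun_prop
  refine ⟨fun t => e t * Φ t, ?_, fun z => ?_⟩
  · obtain ⟨C, hC⟩ := (isCompact_Icc (a := a) (b := b)).exists_bound_of_continuousOn
      hec.continuousOn
    refine MemLp.of_le_mul (c := C) hΦL (hec.aestronglyMeasurable.mul hΦm) ?_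
    filter_upwards [ae_restrict_mem measurableSet_Ioc] with t ht
    rw [norm_mul]
    exact mul_le_mul_of_nonneg_right (hC t ⟨ht.1.le, ht.2⟩) (norm_nonneg _)
  by_cases hzw : z = w
  · rw [hzw, h0, sub_self, zero_mul]
  have hu : z - w ≠ 0 := sub_ne_zero.2 hzw
  have hI : pwTransform (Set.Ioc a b) (fun t => e t * Φ t) z =
      ∫ t, ∫ s, (Set.Ici s).indicator
        (fun t : ℝ => (-Complex.I * Complex.exp (Complex.I * t * (z - w))) * g s) t ∂ν ∂ν := by
    unfold pwTransform
    congr 1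
    ext t
    rw [mul_right_comm, hΦ, ← integral_const_mul]
    congr 1
    ext s
    by_cases hst : s ≤ t
    · simp only [Set.indicator_of_mem (Set.mem_Ici.2 hst), he]
      rw [mul_assoc (-Complex.I), ← Complex.exp_add]
      ring_nf
    · simp [hst]
  rw [hI, integral_integral_swap (hprod _ (by fun_prop))]
  have hin : ∀ᵐ s ∂ν, ∫ t, (Set.Ici s).indicator
        (fun t : ℝ => (-Complex.I * Complex.exp (Complex.I * t * (z - w))) * g s) t ∂ν =
      (z - w)⁻¹ * (φ s * Complex.exp (Complex.I * s * z)
        - Complex.exp (Complex.I * b * (z - w)) * g s) := by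
    filter_upwards [ae_restrict_mem measurableSet_Ioc] with s hs
    have h1 := integral_indicator_Ici_exp hs hu
    have h2 : ∀ t : ℝ, (Set.Ici s).indicator
        (fun t : ℝ => (-Complex.I * Complex.exp (Complex.I * t * (z - w))) * g s) t =
        (-Complex.I * g s) *
          (Set.Ici s).indicator (fun t : ℝ => Complex.exp (Complex.I * t * (z - w))) t := by
      intro t
      by_cases hst : s ≤ t
      · simp only [Set.indicator_of_mem (Set.mem_Ici.2 hst)]
        ring
      · simp [hst]
    simp_rw [h2]
    rw [integral_const_mul, h1]
    have h3 : φ s * Complex.exp (Complex.I * s * z) =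
        g s * Complex.exp (Complex.I * s * (z - w)) := by
      simp only [hg]
      rw [mul_assoc (φ s) (Complex.exp _), ← Complex.exp_add]
      ring_nf
    rw [h3]
    field_simp
    ring
  rw [integral_congr_ae hin, integral_const_mul,
    integral_sub (integrableOn_pwTransform hb hφ z) (hgi.const_mul _), integral_const_mul,
    ← mul_assoc, mul_inv_cancel₀ hu, one_mul]
  -- The boundary term at `b` disappears exactly because the transform vanishes at `w`.
  have h4 : ∫ s, g s ∂ν = 0 := h0
  rw [h4, mul_zero, sub_zero]
  rfl

theorem IsBoundedInterval.exists_pwTransform_eq_sub_mul (hJ : IsBoundedInterval J)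
    (hφ : IntegrableOn φ J) {w : ℂ} (h0 : pwTransform J φ w = 0) :
    ∃ ψ : ℝ → ℂ, MemLp ψ 2 (volume.restrict J) ∧
      ∀ z, pwTransform J φ z = (z - w) * pwTransform J ψ z := by
  have hae := hJ.ae_eq_Ioc
  rw [IntegrableOn, Measure.restrict_congr_set hae] at hφ
  simp_rw [pwTransform_congr_set hae, Measure.restrict_congr_set hae] at h0 ⊢
  exact exists_pwTransform_Ioc_eq_sub_mul hφ h0

theorem differentiable_pwTransform (hb : Bornology.IsBounded J) (hφ : IntegrableOn φ J) :
    Differentiable ℂ (pwTransform J φ) := by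
  intro z₀
  obtain ⟨C, hC⟩ := ((hb.isCompact_closure).prod
    (isCompact_closedBall z₀ 1)).exists_bound_of_continuousOn (f := fun p : ℝ × ℂ =>
      Complex.exp (Complex.I * p.1 * p.2) * (Complex.I * p.1)) (by fun_prop)
  have hcl : ∀ᵐ t ∂volume.restrict J, t ∈ closure J :=
    ae_restrict_of_ae_restrict_of_subset subset_closure
      (ae_restrict_mem isClosed_closure.measurableSet)
  refine (hasDerivAt_integral_of_dominated_loc_of_deriv_le (μ := volume.restrict J)
    (F := fun (z : ℂ) (t : ℝ) => φ t * Complex.exp (Complex.I * t * z))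
    (F' := fun (z : ℂ) (t : ℝ) => φ t * (Complex.exp (Complex.I * t * z) * (Complex.I * t)))
    (bound := fun t => ‖φ t‖ * C)
    (Metric.closedBall_mem_nhds z₀ one_pos)
    (Eventually.of_forall fun z => (integrableOn_pwTransform hb hφ z).1)
    (integrableOn_pwTransform hb hφ z₀)
    (integrableOn_mul_continuous hb hφ (by fun_prop)).1 ?_ (hφ.norm.mul_const C)
    ?_).2.differentiableAt
  · filter_upwards [hcl] with t ht z hz
    rw [norm_mul]
    exact mul_le_mul_of_nonneg_left (hC (t, z) ⟨ht, hz⟩) (norm_nonneg _)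
  · refine ae_of_all _ fun t z _ => ?_
    have h := ((hasDerivAt_id z).const_mul (Complex.I * (t : ℂ))).cexp.const_mul (φ t)
    simpa using h

end Division

/-! ### Splitting and gluing over disjoint intervals -/

section IntervalUnion

variable {J : Set ℝ} {n : ℕ} {I : Fin n → Set ℝ}

theorem IsBoundedInterval.measurableSet (hJ : IsBoundedInterval J) : MeasurableSet J :=
  hJ.1.measurableSet

theorem pwTransform_add (hb : Bornology.IsBounded J) {φ ψ : ℝ → ℂ} (hφ : IntegrableOn φ J)
    (hψ : IntegrableOn ψ J) (z : ℂ) :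
    pwTransform J (φ + ψ) z = pwTransform J φ z + pwTransform J ψ z := by
  unfold pwTransform
  rw [← integral_add (integrableOn_pwTransform hb hφ z) (integrableOn_pwTransform hb hψ z)]
  simp [add_mul]

theorem pwTransform_smul (c : ℂ) (φ : ℝ → ℂ) (z : ℂ) :
    pwTransform J (c • φ) z = c * pwTransform J φ z := by
  unfold pwTransform
  rw [← integral_const_mul]
  simp [mul_assoc]

theorem pwTransform_sum_smul (hb : Bornology.IsBounded J) {ι : Type*} [Fintype ι]
    {φ : ι → ℝ → ℂ} (hφ : ∀ k, IntegrableOn (φ k) J) (c : ι → ℂ) (z : ℂ) :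
    pwTransform J (∑ k, c k • φ k) z = ∑ k, c k * pwTransform J (φ k) z := by
  simp_rw [← pwTransform_smul]
  unfold pwTransform
  rw [← integral_finsetSum]
  · simp [Finset.sum_mul]
  · intro k _
    exact integrableOn_pwTransform hb ((hφ k).smul (c k)) z

theorem memLp_sum_smul {ι : Type*} [Fintype ι] {φ : ι → ℝ → ℂ}
    (hφ : ∀ k, MemLp (φ k) 2 (volume.restrict J)) (c : ι → ℂ) :
    MemLp (∑ k, c k • φ k) 2 (volume.restrict J) :=
  memLp_finsetSum' _ fun k _ => (hφ k).const_smul (c k)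

theorem pwTransform_iUnion (hI : ∀ j, IsBoundedInterval (I j))
    (hdisj : ∀ i j, i ≠ j → Disjoint (I i) (I j)) {φ : ℝ → ℂ}
    (hφ : ∀ j, IntegrableOn φ (I j)) (z : ℂ) :
    pwTransform (⋃ j, I j) φ z = ∑ j, pwTransform (I j) φ z :=
  integral_iUnion_fintype (fun j => (hI j).measurableSet) (fun i j h => hdisj i j h)
    fun j => integrableOn_pwTransform (hI j).2.1 (hφ j) z

/-- Densities on disjoint intervals glue to one on their union. -/
theorem exists_paleyWiener_eq_sum (hI : ∀ j, IsBoundedInterval (I j))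
    (hdisj : ∀ i j, i ≠ j → Disjoint (I i) (I j)) {ψ : Fin n → ℝ → ℂ}
    (hψ : ∀ j, MemLp (ψ j) 2 (volume.restrict (I j))) :
    ∃ g ∈ PaleyWiener (⋃ j, I j), ∀ z, g z = ∑ j, pwTransform (I j) (ψ j) z := by
  set Ψ : ℝ → ℂ := ∑ j, (I j).indicator (ψ j) with hΨ
  have hL : MemLp Ψ 2 := memLp_finsetSum' _ fun j _ =>
    (memLp_indicator_iff_restrict (hI j).measurableSet).2 (hψ j)
  have heq : ∀ j, ∀ t ∈ I j, Ψ t = ψ j t := by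
    intro j t ht
    rw [hΨ, Finset.sum_apply, Finset.sum_eq_single j, Set.indicator_of_mem ht]
    · intro i _ hij
      exact Set.indicator_of_notMem ((hdisj i j hij).notMem_of_mem_right ht) _
    · simp
  refine ⟨_, ⟨Ψ, hL.restrict _, rfl⟩, fun z => ?_⟩
  rw [pwTransform_iUnion hI hdisj fun j =>
    integrableOn_of_memLp_two (hI j).2.1 (hL.restrict _)]
  refine Finset.sum_congr rfl fun j _ => setIntegral_congr_fun (hI j).measurableSet ?_
  intro t ht
  simp only [heq j t ht]

/-- The sum need not be a transform of an `L²` density, so division is not applied to it directly.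
Writing `z - p k = (z - w) + (w - p k)` leaves a term already divisible by `z - w` and a genuine
transform vanishing at `w`. -/
theorem exists_sum_sub_mul_pwTransform_eq (hJ : IsBoundedInterval J) {ι : Type*} [Fintype ι]
    {φ : ι → ℝ → ℂ} (hφ : ∀ k, MemLp (φ k) 2 (volume.restrict J)) (a p : ι → ℂ) {w : ℂ}
    (h0 : ∑ k, a k * ((w - p k) * pwTransform J (φ k) w) = 0) :
    ∃ ψ : ℝ → ℂ, MemLp ψ 2 (volume.restrict J) ∧
      ∀ z, ∑ k, a k * ((z - p k) * pwTransform J (φ k) z) = (z - w) * pwTransform J ψ z := by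
  have hi := fun k => integrableOn_of_memLp_two hJ.2.1 (hφ k)
  set χ : ℝ → ℂ := ∑ k, (a k * (w - p k)) • φ k with hχ
  have hχL : MemLp χ 2 (volume.restrict J) := memLp_sum_smul hφ _
  have hχw : pwTransform J χ w = 0 := by
    rw [hχ, pwTransform_sum_smul hJ.2.1 hi, ← h0]
    exact Finset.sum_congr rfl fun k _ => mul_assoc _ _ _
  obtain ⟨ψ, hψ, hd⟩ := hJ.exists_pwTransform_eq_sub_mul
    (integrableOn_of_memLp_two hJ.2.1 hχL) hχw
  have hsL : MemLp (∑ k, a k • φ k) 2 (volume.restrict J) := memLp_sum_smul hφ _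
  refine ⟨(∑ k, a k • φ k) + ψ, hsL.add hψ, fun z => ?_⟩
  rw [pwTransform_add hJ.2.1 (integrableOn_of_memLp_two hJ.2.1 hsL)
    (integrableOn_of_memLp_two hJ.2.1 hψ), mul_add, ← hd, hχ, pwTransform_sum_smul hJ.2.1 hi,
    pwTransform_sum_smul hJ.2.1 hi, Finset.mul_sum, ← Finset.sum_add_distrib]
  refine Finset.sum_congr rfl fun k _ => ?_
  ring

/-- The chosen density depends on `f` and `E` but not on `J`, so one `φ` serves all the parts of
`f`. -/
theorem exists_pwComponent_eq {E : Set ℝ} {f : ℂ → ℂ} (hf : f ∈ PaleyWiener E) :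
    ∃ φ : ℝ → ℂ, MemLp φ 2 (volume.restrict E) ∧ f = pwTransform E φ ∧
      ∀ J, pwComponent E J f = pwTransform J φ :=
  ⟨hf.choose, hf.choose_spec.1, hf.choose_spec.2, fun _ => dif_pos hf⟩

theorem sub_mem_paleyWiener {E : Set ℝ} (hb : Bornology.IsBounded E) {f g : ℂ → ℂ}
    (hf : f ∈ PaleyWiener E) (hg : g ∈ PaleyWiener E) (c : ℂ) :
    (fun z => f z - c * g z) ∈ PaleyWiener E := by
  obtain ⟨φ, hφ, rfl⟩ := hf
  obtain ⟨ψ, hψ, rfl⟩ := hg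
  refine ⟨φ + (-c) • ψ, hφ.add (hψ.const_smul _), ?_⟩
  ext z
  rw [pwTransform_add hb (integrableOn_of_memLp_two hb hφ)
    (integrableOn_of_memLp_two hb (hψ.const_smul _)), pwTransform_smul]
  ring

theorem differentiable_of_mem_paleyWiener {E : Set ℝ} (hb : Bornology.IsBounded E) {f : ℂ → ℂ}
    (hf : f ∈ PaleyWiener E) : Differentiable ℂ f := by
  obtain ⟨φ, hφ, rfl⟩ := hf
  exact differentiable_pwTransform hb (integrableOn_of_memLp_two hb hφ)

end IntervalUnion

/-! ### The matrix of parts: kernels, cofactors and determinant -/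

section PartMatrix

variable {n : ℕ} {I : Fin (n + 1) → Set ℝ} {Λ : Set ℂ} {f : Λ → ℂ → ℂ}
  {lam : Fin (n + 1) → Λ}

theorem isBounded_iUnion_interval (hI : ∀ j, IsBoundedInterval (I j)) :
    Bornology.IsBounded (⋃ j, I j) :=
  Bornology.isBounded_iUnion.2 fun j => (hI j).2.1

theorem measurableSet_iUnion_interval (hI : ∀ j, IsBoundedInterval (I j)) :
    MeasurableSet (⋃ j, I j) :=
  MeasurableSet.iUnion fun j => (hI j).measurableSet

theorem cofactor_eq_adjugate (M : Matrix (Fin (n + 1)) (Fin (n + 1)) ℂ) (k l : Fin (n + 1)) :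
    cofactor M k l = M.adjugate l k :=
  (Matrix.adjugate_fin_succ_eq_det_submatrix M l k).symm

theorem differentiable_det {m : ℕ} {M : ℂ → Matrix (Fin m) (Fin m) ℂ}
    (hM : ∀ i j, Differentiable ℂ fun z => M z i j) : Differentiable ℂ fun z => (M z).det := by
  simp only [Matrix.det_apply']
  fun_prop

theorem differentiable_cofactor {M : ℂ → Matrix (Fin (n + 1)) (Fin (n + 1)) ℂ}
    (hM : ∀ i j, Differentiable ℂ fun z => M z i j) (k l : Fin (n + 1)) :
    Differentiable ℂ fun z => cofactor (M z) k l :=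
  (differentiable_det fun i j => hM (k.succAbove i) (l.succAbove j)).const_mul _

/-- If a matrix with vanishing row sums has a left kernel of dimension at most one, then no column
of cofactors vanishes. -/
theorem exists_cofactor_ne_zero {M : Matrix (Fin (n + 1)) (Fin (n + 1)) ℂ}
    (hrow : ∀ k, ∑ j, M k j = 0)
    (hker : ∀ a b : Fin (n + 1) → ℂ, a ≠ 0 → Matrix.vecMul a M = 0 → Matrix.vecMul b M = 0 →
      ∃ c : ℂ, b = c • a) (l : Fin (n + 1)) : ∃ k, cofactor M k l ≠ 0 := by
  by_contra! hall
  -- If the cofactors of column `l` vanish, putting any `b` in column `l` gives a singular matrix. A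
  -- left null vector of it kills the other columns of `M`, hence column `l` too, as the columns sum
  -- to zero. So every `b` is annihilated by a nonzero vector of the left kernel.
  have key : ∀ b : Fin (n + 1) → ℂ, ∃ a ≠ 0, Matrix.vecMul a M = 0 ∧ ∑ k, a k * b k = 0 := by
    intro b
    have hdet : (M.updateCol l b).det = 0 := by
      rw [← Matrix.cramer_apply, Matrix.cramer_eq_adjugate_mulVec, Matrix.mulVec, dotProduct]
      refine Finset.sum_eq_zero fun k _ => ?_
      rw [← cofactor_eq_adjugate, hall, zero_mul]
    obtain ⟨a, ha, hv⟩ := Matrix.exists_vecMul_eq_zero_iff.2 hdet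
    have hne : ∀ j, j ≠ l → ∑ k, a k * M k j = 0 := by
      intro j hj
      have := congrFun hv j
      simpa [Matrix.vecMul, dotProduct, Matrix.updateCol_ne hj] using this
    refine ⟨a, ha, ?_, by simpa [Matrix.vecMul, dotProduct] using congrFun hv l⟩
    ext j
    rw [Pi.zero_apply, Matrix.vecMul, dotProduct]
    by_cases hj : j = l
    · have hs : ∑ j, ∑ k, a k * M k j = 0 := by
        rw [Finset.sum_comm]
        simp [← Finset.mul_sum, hrow]
      rw [Finset.sum_eq_single l (fun j _ hj => hne j hj) (by simp)] at hs
      rw [hj, hs]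
    · exact hne j hj
  obtain ⟨a, ha, hav, -⟩ := key 0
  obtain ⟨i, hi⟩ := Function.ne_iff.1 ha
  -- With `a i ≠ 0`, this second kernel vector has `i`-th entry zero, so it cannot be a nonzero
  -- multiple of `a`.
  obtain ⟨b, hb, hbv, hbi⟩ := key (Pi.single i 1)
  obtain ⟨c, rfl⟩ := hker a b ha hav hbv
  have hc : c = 0 := by
    have : c * a i = 0 := by simpa [Pi.single_apply] using hbi
    exact (mul_eq_zero.1 this).resolve_right hi
  exact hb (by rw [hc, zero_smul])

theorem differentiable_partMatrix (hI : ∀ j, IsBoundedInterval (I j))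
    (hf : ∀ μ, f μ ∈ PaleyWiener (⋃ j, I j)) (k j : Fin (n + 1)) :
    Differentiable ℂ fun z => partMatrix I f lam z k j := by
  obtain ⟨φ, hφ, -, hc⟩ := exists_pwComponent_eq (hf (lam k))
  have := differentiable_pwTransform (hI j).2.1 ((integrableOn_of_memLp_two
    (isBounded_iUnion_interval hI) hφ).mono_set (Set.subset_iUnion I j))
  simp only [partMatrix, bigFPart, Matrix.of_apply, hc]
  fun_prop

theorem sum_partMatrix (hI : ∀ j, IsBoundedInterval (I j))
    (hdisj : ∀ i j, i ≠ j → Disjoint (I i) (I j))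
    (hf : ∀ μ, f μ ∈ PaleyWiener (⋃ j, I j)) (k : Fin (n + 1)) (z : ℂ) :
    ∑ j, partMatrix I f lam z k j = bigF f (lam k) z := by
  obtain ⟨φ, hφ, he, hc⟩ := exists_pwComponent_eq (hf (lam k))
  have hi := integrableOn_of_memLp_two (isBounded_iUnion_interval hI) hφ
  simp only [partMatrix, bigFPart, Matrix.of_apply, hc, bigF]
  rw [← Finset.mul_sum, he, pwTransform_iUnion hI hdisj fun j =>
    hi.mono_set (Set.subset_iUnion I j)]

/-- A combination of the `F_k` all of whose parts vanish at `w` is divisible by `z - w` within the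
Paley-Wiener space. -/
theorem exists_paleyWiener_sub_mul (hI : ∀ j, IsBoundedInterval (I j))
    (hdisj : ∀ i j, i ≠ j → Disjoint (I i) (I j))
    (hf : ∀ μ, f μ ∈ PaleyWiener (⋃ j, I j)) {a : Fin (n + 1) → ℂ} {w : ℂ}
    (ha : Matrix.vecMul a (partMatrix I f lam w) = 0) :
    ∃ g ∈ PaleyWiener (⋃ j, I j), ∀ z, ∑ k, a k * bigF f (lam k) z = (z - w) * g z := by
  choose φ hφ he hc using fun k => exists_pwComponent_eq (hf (lam k))
  have hP : ∀ z k j, partMatrix I f lam z k j =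
      (z - (lam k : ℂ)) * pwTransform (I j) (φ k) z := by
    intro z k j
    simp only [partMatrix, bigFPart, Matrix.of_apply, hc]
  have hL : ∀ j k, MemLp (φ k) 2 (volume.restrict (I j)) := fun j k =>
    (hφ k).mono_measure (Measure.restrict_mono (Set.subset_iUnion I j) le_rfl)
  have h0 : ∀ j, ∑ k, a k * ((w - (lam k : ℂ)) * pwTransform (I j) (φ k) w) = 0 := by
    intro j
    simpa [Matrix.vecMul, dotProduct, hP] using congrFun ha j
  choose ψ hψ hd using fun j =>
    exists_sum_sub_mul_pwTransform_eq (hI j) (hL j) a (fun k => (lam k : ℂ)) (h0 j)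
  obtain ⟨g, hg, hgs⟩ := exists_paleyWiener_eq_sum hI hdisj hψ
  refine ⟨g, hg, fun z => ?_⟩
  simp_rw [hgs, Finset.mul_sum, ← hd, ← sum_partMatrix hI hdisj hf, hP, Finset.mul_sum]
  exact Finset.sum_comm

theorem IsBiorthogonalSystem.apply_self (hI : ∀ j, IsBoundedInterval (I j))
    (hf : IsBiorthogonalSystem (PaleyWiener (⋃ j, I j))
      (fun μ : Λ => pwKernel (⋃ j, I j) (μ : ℂ)) f) (μ : Λ) : f μ μ = 1 := by
  rw [← hf.2.1 μ, realLineInner_pwKernel (measurableSet_iUnion_interval hI)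
    (isBounded_iUnion_interval hI) (hf.1 μ)]

theorem IsBiorthogonalSystem.apply_of_ne (hI : ∀ j, IsBoundedInterval (I j))
    (hf : IsBiorthogonalSystem (PaleyWiener (⋃ j, I j))
      (fun μ : Λ => pwKernel (⋃ j, I j) (μ : ℂ)) f) {μ ν : Λ} (h : μ ≠ ν) : f μ ν = 0 := by
  rw [← hf.2.2 μ ν h, realLineInner_pwKernel (measurableSet_iUnion_interval hI)
    (isBounded_iUnion_interval hI) (hf.1 μ)]

theorem IsBiorthogonalSystem.bigF_eq_zero (hI : ∀ j, IsBoundedInterval (I j))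
    (hf : IsBiorthogonalSystem (PaleyWiener (⋃ j, I j))
      (fun μ : Λ => pwKernel (⋃ j, I j) (μ : ℂ)) f) (μ ν : Λ) : bigF f μ ν = 0 := by
  rw [bigF]
  by_cases h : μ = ν
  · rw [h, sub_self, zero_mul]
  · rw [hf.apply_of_ne hI h, mul_zero]

/-- The left kernel of `(F_k^j(w))` is trivial for `w ∉ Λ`. -/
theorem eq_zero_of_vecMul_partMatrix (hI : ∀ j, IsBoundedInterval (I j))
    (hdisj : ∀ i j, i ≠ j → Disjoint (I i) (I j))
    (hcomplete : IsCompleteSystem (PaleyWiener (⋃ j, I j))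
      (fun μ : Λ => pwKernel (⋃ j, I j) (μ : ℂ)))
    (hf : IsBiorthogonalSystem (PaleyWiener (⋃ j, I j))
      (fun μ : Λ => pwKernel (⋃ j, I j) (μ : ℂ)) f)
    (hlin : LinearIndependent ℂ (fun k => bigF f (lam k)))
    {a : Fin (n + 1) → ℂ} {w : ℂ} (hw : w ∉ Λ)
    (ha : Matrix.vecMul a (partMatrix I f lam w) = 0) : a = 0 := by
  obtain ⟨g, hg, hd⟩ := exists_paleyWiener_sub_mul hI hdisj hf.1 ha
  have hg0 : g = 0 := by
    refine eq_zero_of_forall_apply_eq_zero (measurableSet_iUnion_interval hI)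
      (isBounded_iUnion_interval hI) hcomplete hg fun μ hμ => ?_
    have h := hd μ
    simp only [fun k => hf.bigF_eq_zero hI (lam k) ⟨μ, hμ⟩, mul_zero, Finset.sum_const_zero] at h
    exact (mul_eq_zero.1 h.symm).resolve_left (sub_ne_zero.2 fun e => hw (e ▸ hμ))
  funext k
  refine Fintype.linearIndependent_iff.1 hlin a ?_ k
  ext z
  simpa [hg0] using hd z

/-- An element of the left kernel of `(F_k^j(μ))`, `μ ∈ Λ`, combines the `F_k` to a multiple
of `F_μ`. -/
theorem exists_sum_mul_bigF_eq (hI : ∀ j, IsBoundedInterval (I j))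
    (hdisj : ∀ i j, i ≠ j → Disjoint (I i) (I j))
    (hcomplete : IsCompleteSystem (PaleyWiener (⋃ j, I j))
      (fun μ : Λ => pwKernel (⋃ j, I j) (μ : ℂ)))
    (hf : IsBiorthogonalSystem (PaleyWiener (⋃ j, I j))
      (fun μ : Λ => pwKernel (⋃ j, I j) (μ : ℂ)) f)
    {a : Fin (n + 1) → ℂ} {μ : Λ} (ha : Matrix.vecMul a (partMatrix I f lam μ) = 0) :
    ∃ d : ℂ, ∀ z, ∑ k, a k * bigF f (lam k) z = d * bigF f μ z := by
  obtain ⟨g, hg, hd⟩ := exists_paleyWiener_sub_mul hI hdisj hf.1 ha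
  have hb := isBounded_iUnion_interval hI
  -- The difference vanishes at `μ` since `f_μ(μ) = 1`; elsewhere on `Λ` both terms vanish.
  have hg0 : (fun z => g z - g μ * f μ z) = 0 := by
    refine eq_zero_of_forall_apply_eq_zero (measurableSet_iUnion_interval hI) hb hcomplete
      (sub_mem_paleyWiener hb hg (hf.1 μ) _) fun ν hν => ?_
    by_cases hνμ : μ = ⟨ν, hν⟩
    · subst hνμ
      have h1 := hf.apply_self hI ⟨ν, hν⟩
      simp only at h1 ⊢
      rw [h1, mul_one, sub_self]
    · have h := hd ν
      simp only [fun k => hf.bigF_eq_zero hI (lam k) ⟨ν, hν⟩, mul_zero,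
        Finset.sum_const_zero] at h
      have hgν := (mul_eq_zero.1 h.symm).resolve_left
        (sub_ne_zero.2 fun e => hνμ (Subtype.ext e.symm))
      have h0 := hf.apply_of_ne hI hνμ
      simp only at h0 ⊢
      rw [h0, hgν, mul_zero, sub_zero]
  refine ⟨g μ, fun z => ?_⟩
  rw [hd, sub_eq_zero.1 (congrFun hg0 z), bigF]
  ring

/-- By independence of the `F_k`, `a ↦ ∑ a_k F_k` is injective. It sends the left kernel into the
line spanned by `F_μ`, so that kernel has dimension at most one. -/
theorem exists_cofactor_partMatrix_ne_zero (hI : ∀ j, IsBoundedInterval (I j))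
    (hdisj : ∀ i j, i ≠ j → Disjoint (I i) (I j))
    (hcomplete : IsCompleteSystem (PaleyWiener (⋃ j, I j))
      (fun μ : Λ => pwKernel (⋃ j, I j) (μ : ℂ)))
    (hf : IsBiorthogonalSystem (PaleyWiener (⋃ j, I j))
      (fun μ : Λ => pwKernel (⋃ j, I j) (μ : ℂ)) f)
    (hlin : LinearIndependent ℂ (fun k => bigF f (lam k))) (μ : Λ) (l : Fin (n + 1)) :
    ∃ k, cofactor (partMatrix I f lam μ) k l ≠ 0 := by
  have hlin' := Fintype.linearIndependent_iff.1 hlin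
  refine exists_cofactor_ne_zero (fun k => ?_) (fun a b ha hav hbv => ?_) l
  · rw [sum_partMatrix hI hdisj hf.1, hf.bigF_eq_zero hI]
  obtain ⟨c, hc⟩ := exists_sum_mul_bigF_eq hI hdisj hcomplete hf hav
  obtain ⟨d, hd⟩ := exists_sum_mul_bigF_eq hI hdisj hcomplete hf hbv
  have hc0 : c ≠ 0 := by
    rintro rfl
    refine ha (funext (hlin' a ?_))
    ext z
    simpa using hc z
  refine ⟨d / c, funext fun k => ?_⟩
  have h := hlin' (fun k => b k - d / c * a k) (by
    ext z
    simp only [Finset.sum_apply, Pi.smul_apply, smul_eq_mul, sub_mul, Finset.sum_sub_distrib,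
      mul_assoc, ← Finset.mul_sum, hc, hd, Pi.zero_apply]
    field_simp
    ring) k
  exact sub_eq_zero.1 h

/-- For `μ ∈ Λ` the function `F_μ` is, up to a nonzero factor, the combination of the `F_k` whose
coefficients are the cofactors of a column of `(F_k^j(μ))`. -/
theorem exists_sum_cofactor_mul_bigF_eq (hI : ∀ j, IsBoundedInterval (I j))
    (hdisj : ∀ i j, i ≠ j → Disjoint (I i) (I j))
    (hcomplete : IsCompleteSystem (PaleyWiener (⋃ j, I j))
      (fun μ : Λ => pwKernel (⋃ j, I j) (μ : ℂ)))
    (hf : IsBiorthogonalSystem (PaleyWiener (⋃ j, I j))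
      (fun μ : Λ => pwKernel (⋃ j, I j) (μ : ℂ)) f)
    (hlin : LinearIndependent ℂ (fun k => bigF f (lam k))) (μ : Λ) (l : Fin (n + 1)) :
    (partMatrix I f lam μ).det = 0 ∧
    ∃ d : ℂ, d ≠ 0 ∧ ∀ z, ∑ k, cofactor (partMatrix I f lam μ) k l * bigF f (lam k) z =
      d * bigF f μ z := by
  have hrow : ∀ k, ∑ j, partMatrix I f lam μ k j = 0 := fun k => by
    rw [sum_partMatrix hI hdisj hf.1, hf.bigF_eq_zero hI]
  have hdet : (partMatrix I f lam μ).det = 0 :=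
    Matrix.exists_mulVec_eq_zero_iff.1 ⟨1, one_ne_zero, by
      ext k
      simpa [Matrix.mulVec, dotProduct] using hrow k⟩
  refine ⟨hdet, ?_⟩
  -- Row `l` of `adj M * M = det M • 1 = 0`.
  have hv : Matrix.vecMul (fun k => cofactor (partMatrix I f lam μ) k l)
      (partMatrix I f lam μ) = 0 := by
    ext j
    have h := congrFun (congrFun (Matrix.adjugate_mul (partMatrix I f lam μ)) l) j
    rw [hdet, zero_smul, Matrix.mul_apply] at h
    simpa [Matrix.vecMul, dotProduct, cofactor_eq_adjugate] using h
  obtain ⟨d, hd⟩ := exists_sum_mul_bigF_eq hI hdisj hcomplete hf hv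
  refine ⟨d, ?_, hd⟩
  rintro rfl
  obtain ⟨k, hk⟩ := exists_cofactor_partMatrix_ne_zero hI hdisj hcomplete hf hlin μ l
  refine hk (Fintype.linearIndependent_iff.1 hlin
    (fun k => cofactor (partMatrix I f lam μ) k l) ?_ k)
  ext z
  simpa using hd z

/-- Adding all other columns to column `l` preserves the determinant and turns that column into the
row sums `F_k`; then expand along it. -/
theorem det_partMatrix_eq_sum (hI : ∀ j, IsBoundedInterval (I j))
    (hdisj : ∀ i j, i ≠ j → Disjoint (I i) (I j))
    (hf : ∀ μ, f μ ∈ PaleyWiener (⋃ j, I j)) (z : ℂ) (l : Fin (n + 1)) :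
    (partMatrix I f lam z).det =
      ∑ k, cofactor (partMatrix I f lam z) k l * bigF f (lam k) z := by
  have h : ((partMatrix I f lam z).adjugate * partMatrix I f lam z).mulVec 1 l =
      (partMatrix I f lam z).det := by
    rw [Matrix.adjugate_mul]
    simp [Matrix.smul_mulVec]
  rw [← h, ← Matrix.mulVec_mulVec, Matrix.mulVec, dotProduct]
  refine Finset.sum_congr rfl fun k _ => ?_
  rw [cofactor_eq_adjugate, ← sum_partMatrix hI hdisj hf]
  simp [Matrix.mulVec, dotProduct]

theorem hasDerivAt_bigF_self (hI : ∀ j, IsBoundedInterval (I j))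
    (hf : IsBiorthogonalSystem (PaleyWiener (⋃ j, I j))
      (fun μ : Λ => pwKernel (⋃ j, I j) (μ : ℂ)) f) (μ : Λ) :
    HasDerivAt (bigF f μ) 1 μ := by
  have hd := differentiable_of_mem_paleyWiener (isBounded_iUnion_interval hI) (hf.1 μ)
  have h : HasDerivAt (bigF f μ) (1 * f μ μ + ((μ : ℂ) - μ) * deriv (f μ) μ) μ :=
    ((hasDerivAt_id (μ : ℂ)).sub_const (μ : ℂ)).mul (hd μ).hasDerivAt
  simpa [hf.apply_self hI] using h

theorem deriv_det_partMatrix_ne_zero (hI : ∀ j, IsBoundedInterval (I j))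
    (hdisj : ∀ i j, i ≠ j → Disjoint (I i) (I j))
    (hcomplete : IsCompleteSystem (PaleyWiener (⋃ j, I j))
      (fun μ : Λ => pwKernel (⋃ j, I j) (μ : ℂ)))
    (hf : IsBiorthogonalSystem (PaleyWiener (⋃ j, I j))
      (fun μ : Λ => pwKernel (⋃ j, I j) (μ : ℂ)) f)
    (hlin : LinearIndependent ℂ (fun k => bigF f (lam k))) (μ : Λ) :
    deriv (fun z => (partMatrix I f lam z).det) μ ≠ 0 := by
  obtain ⟨-, d, hd0, hd⟩ := exists_sum_cofactor_mul_bigF_eq hI hdisj hcomplete hf hlin μ 0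
  have hF : ∀ k, Differentiable ℂ (bigF f (lam k)) := fun k => by
    have := differentiable_of_mem_paleyWiener (isBounded_iUnion_interval hI) (hf.1 (lam k))
    unfold bigF
    fun_prop
  have hC : ∀ k, Differentiable ℂ fun z => cofactor (partMatrix I f lam z) k 0 := fun k =>
    differentiable_cofactor (differentiable_partMatrix hI hf.1) k 0
  -- With the cofactors frozen at `μ` the sum is `d F_μ`, of derivative `d` at `μ`. Letting them
  -- vary adds only terms with a factor `F_k(μ) = 0`.
  have h1 : HasDerivAt (fun z => ∑ k, cofactor (partMatrix I f lam μ) k 0 * bigF f (lam k) z)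
      (∑ k, cofactor (partMatrix I f lam μ) k 0 * deriv (bigF f (lam k)) μ) μ :=
    HasDerivAt.fun_sum fun k _ => (hF k μ).hasDerivAt.const_mul _
  have h2 : HasDerivAt (fun z => ∑ k, cofactor (partMatrix I f lam μ) k 0 * bigF f (lam k) z)
      (d * 1) μ := by
    simp_rw [hd]
    exact (hasDerivAt_bigF_self hI hf μ).const_mul d
  have h3 : HasDerivAt (fun z => (partMatrix I f lam z).det)
      (∑ k, (deriv (fun z => cofactor (partMatrix I f lam z) k 0) μ * bigF f (lam k) μ +
        cofactor (partMatrix I f lam μ) k 0 * deriv (bigF f (lam k)) μ)) μ := by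
    simp_rw [det_partMatrix_eq_sum hI hdisj hf.1 _ 0]
    exact HasDerivAt.fun_sum fun k _ => (hC k μ).hasDerivAt.mul (hF k μ).hasDerivAt
  have h4 := h3.deriv
  simp only [fun k => hf.bigF_eq_zero hI (lam k) μ, mul_zero, zero_add] at h4
  rw [h4, h1.unique h2, mul_one]
  exact hd0

end PartMatrix

/-! ### The biorthogonal system and the zeros of `S` -/

theorem mainTheorem3 (n : ℕ) (I : Fin (n + 1) → Set ℝ)
    (hI : ∀ j, IsBoundedInterval (I j))
    (hdisj : ∀ i j, i ≠ j → Disjoint (I i) (I j))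
    (Λ : Set ℂ)
    (hcomplete : IsCompleteSystem (PaleyWiener (⋃ j, I j))
      (fun μ : Λ => pwKernel (⋃ j, I j) (μ : ℂ)))
    (hminimal : IsMinimalSystem (fun μ : Λ => pwKernel (⋃ j, I j) (μ : ℂ)))
    (hdens : upperDensity Λ = volume (⋃ j, I j) / ENNReal.ofReal (2 * Real.pi))
    (f : Λ → ℂ → ℂ)
    (hf : IsBiorthogonalSystem (PaleyWiener (⋃ j, I j))
      (fun μ : Λ => pwKernel (⋃ j, I j) (μ : ℂ)) f)
    (lam : Fin (n + 1) → Λ)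
    (hlin : LinearIndependent ℂ (fun k => bigF f (lam k))) :
    (∀ (μ : Λ) (l : Fin (n + 1)), ∃ c : ℂ, c ≠ 0 ∧ ∀ z : ℂ, z ≠ (μ : ℂ) →
      f μ z = c / (z - (μ : ℂ)) *
        ∑ k, cofactor (partMatrix I f lam (μ : ℂ)) k l * bigF f (lam k) z) ∧
    Differentiable ℂ (fun z : ℂ => (partMatrix I f lam z).det) ∧
    {z : ℂ | (partMatrix I f lam z).det = 0} = Λ ∧
    (∀ μ ∈ Λ, analyticOrderAt (fun z : ℂ => (partMatrix I f lam z).det) μ = 1) := by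
  have hdiff := differentiable_det (differentiable_partMatrix (lam := lam) hI hf.1)
  refine ⟨fun μ l => ?_, hdiff, ?_, fun μ hμ => ?_⟩
  · obtain ⟨-, d, hd0, hd⟩ := exists_sum_cofactor_mul_bigF_eq hI hdisj hcomplete hf hlin μ l
    refine ⟨d⁻¹, inv_ne_zero hd0, fun z hz => ?_⟩
    have hz' := sub_ne_zero.2 hz
    rw [hd, bigF]
    field_simp
  · ext w
    refine ⟨fun hw => ?_, fun hw =>
      (exists_sum_cofactor_mul_bigF_eq hI hdisj hcomplete hf hlin ⟨w, hw⟩ 0).1⟩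
    by_contra hwΛ
    obtain ⟨a, ha, hav⟩ := Matrix.exists_vecMul_eq_zero_iff.2 hw
    exact ha (eq_zero_of_vecMul_partMatrix hI hdisj hcomplete hf hlin hwΛ hav)
  · exact (hdiff.analyticAt μ).analyticOrderAt_eq_one_of_zero_deriv_ne_zero
      (exists_sum_cofactor_mul_bigF_eq hI hdisj hcomplete hf hlin ⟨μ, hμ⟩ 0).1
      (deriv_det_partMatrix_ne_zero hI hdisj hcomplete hf hlin ⟨μ, hμ⟩)
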